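/- **Setting.** Fix $\hbar>0$. A particle on the line has the algebra of attributes $\mathcal A$ generated by $Q=x$ and $P=-i\hbar\,\frac{d}{dx}$ on the Schwartz space $\mathcal S(\mathbb R)$. The system of two such particles has the algebra $\mathcal A_{12}$ generated by $Q_1=Q\otimes I$, $P_1=P\otimes I$, $Q_2=I\otimes Q$, $P_2=I\otimes P$ on $\mathcal S(\mathbb R^2)$. A *state* $\rho$ on such an algebra is a linear functional $A\mapsto \mathrm{Tr}(\rho A)$ (notation only) with $\mathrm{Tr}(\rho I)=1$ and $\mathrm{Tr}(\rho A)\ge 0$ whenever $A\ge 0$ on the Schwartz space in the $L^2$ sense. State spaces carry the weak topology generated by the functions $\rho\mapsto\mathrm{Tr}(\rho A)$. For a set $W$ of states (a *condition*; in particular $W$ may be open in the state space or relatively open in the set of product states) and a symmetric $A$, the qr-number value $a|_W$ is the function $\rho\mapsto \mathrm{Tr}(\rho A)$ on $W$. The reduced states $\tilde\rho_1,\tilde\rho_2$ of a two-particle state $\rho$ are given by $\mathrm{Tr}(\tilde\rho_1A)=\mathrm{Tr}(\rho\,(A\otimes I))$ and $\mathrm{Tr}(\tilde\rho_2B)=\mathrm{Tr}(\rho\,(I\otimes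 B))$. A condition $W$ of the two-particle system is a *product condition* if $\mathrm{Tr}(\rho\,(A\otimes B))=\mathrm{Tr}(\tilde\rho_1A)\,\mathrm{Tr}(\tilde\rho_2B)$ for all $\rho\in W$ and all symmetric $A,B\in\mathcal A$; otherwise it is *entangled*. **Lemma L6.** Let the particles interact during the time interval $[0,T]$, $T>0$, through the von Neumann interaction with Hamiltonian $\gamma\,Q_1P_2$, $\gamma\neq0$, and put $\kappa=\gamma T$. 1. There is exactly one evolution of states $\rho\mapsto\rho_t$ ($t\in\mathbb R$) of the form $\mathrm{Tr}(\rho_tA)=\mathrm{Tr}(\rho\,U_t^{*}AU_t)$ with $U_t^*AU_t\in\mathcal A_{12}$ for all $A\in\mathcal A_{12}$, where $(U_t)$ is a one-parameter group of $L^2$-isometric linear bijections of $\mathcal S(\mathbb R^2)$ that solves $i\hbar\,\frac{d}{dt}U_t\psi=\gamma Q_1P_2\,U_t\psi$ in $L^2$ for every $\psi\in\mathcal S(\mathbb R^2)$. Moreover $\rho_0=\rho$, and each $\rho\mapsto\rho_t$ is a homeomorphism of the state space. Write $W(t)=\{\rho_t:\rho\in W\}$. 2. For every condition $W$: (a) every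 solution on $[0,T]$ of the qr-number Hamilton equations $\dot q_j=\partial h/\partial p_j$, $\dot p_j=-\partial h/\partial q_j$ ($j=1,2$), pointwise on $W$, with $h(q_1,p_1,q_2,p_2)=\gamma q_1p_2$ and initial positions $q_1(0)=q_1|_W$, $q_2(0)=q_2|_W$, satisfies $q_2(T)=q_2|_W+\kappa\,q_1|_W$ and $q_1(T)=q_1|_W$; (b) the functions $q_j(t)(\rho)=\mathrm{Tr}(\rho_tQ_j)$, $p_j(t)(\rho)=\mathrm{Tr}(\rho_tP_j)$, $\rho\in W$, solve these equations on $[0,T]$; (c) $q_2|_{W(T)}=q_2|_{W(0)}+\kappa\,q_1|_{W(0)}$ and $q_1|_{W(T)}=q_1|_{W(0)}$; that is, $\mathrm{Tr}(\rho_TQ_2)=\mathrm{Tr}(\rho Q_2)+\kappa\,\mathrm{Tr}(\rho Q_1)$ and $\mathrm{Tr}(\rho_TQ_1)=\mathrm{Tr}(\rho Q_1)$ for all $\rho\in W$. 3. If $W$ is a nonempty product condition, then for every $\rho\in W$ $$\mathrm{Tr}(\rho_T\,Q\otimes Q)=\mathrm{Tr}(\tilde\rho_1Q)\,\mathrm{Tr}(\tilde\rho_2Q)+\kappa\,\mathrm{Tr}(\tilde\rho_1Q^2),$$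 and this number differs both from $\mathrm{Tr}(\tilde\rho_1Q)\,\mathrm{Tr}(\tilde\rho_2Q)$ and from $\mathrm{Tr}(\widetilde{(\rho_T)}_1Q)\,\mathrm{Tr}(\widetilde{(\rho_T)}_2Q)$, the product of the values at the reduced states at time $T$. In particular the joint condition $W(T)$ is entangled. -/

import Mathlib

open MeasureTheory Complex
open scoped SchwartzMap LineDeriv

noncomputable section

namespace QR

/-! ### Operators on Schwartz functions and their `L²` form -/

section Operators

variable {E : Type*} [NormedAddCommGroup E] [NormedSpace ℝ E]

/-- Position operator `(Q_ℓ ψ)(x) = ℓ(x) ψ(x)` attached to a linear coordinate `ℓ`. -/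
def position (ℓ : E →L[ℝ] ℝ) : Module.End ℂ 𝓢(E, ℂ) :=
  (SchwartzMap.smulLeftCLM ℂ (fun x : E => ((ℓ x : ℝ) : ℂ))).toLinearMap

/-- Momentum operator `P_v = -iħ ∂_v` in the direction `v`. -/
def momentum (ħ : ℝ) (v : E) : Module.End ℂ 𝓢(E, ℂ) :=
  (-(I * (ħ : ℂ))) • (LineDeriv.lineDerivOpCLM ℂ 𝓢(E, ℂ) v).toLinearMap

theorem position_apply (ℓ : E →L[ℝ] ℝ) (ψ : 𝓢(E, ℂ)) (x : E) :
    position ℓ ψ x = (ℓ x : ℂ) * ψ x := by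
  have h : (fun x : E => ((ℓ x : ℝ) : ℂ)).HasTemperateGrowth :=
    (Complex.ofRealCLM.comp ℓ).hasTemperateGrowth
  simp [position, SchwartzMap.smulLeftCLM_apply_apply h]

theorem momentum_apply (ħ : ℝ) (v : E) (ψ : 𝓢(E, ℂ)) (x : E) :
    momentum ħ v ψ x = -(I * (ħ : ℂ)) * lineDeriv ℝ ψ x v := by
  simp [momentum, SchwartzMap.lineDerivOp_apply]

variable [FiniteDimensional ℝ E] [MeasureSpace E] [BorelSpace E]
  [(volume : Measure E).HasTemperateGrowth]

/-- The `L²` inner product `⟨φ, ψ⟩ = ∫ conj(φ) ψ` of two Schwartz functions. -/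
def innerL2 (φ ψ : 𝓢(E, ℂ)) : ℂ :=
  inner ℂ (φ.toLp 2 (volume : Measure E)) (ψ.toLp 2 (volume : Measure E))

theorem innerL2_eq_integral (φ ψ : 𝓢(E, ℂ)) :
    innerL2 φ ψ = ∫ x, inner ℂ (φ x) (ψ x) :=
  SchwartzMap.inner_toL2_toL2_eq φ ψ volume

/-- `A` is a symmetric operator on the domain of Schwartz functions. -/
def IsSymm (A : Module.End ℂ 𝓢(E, ℂ)) : Prop :=
  ∀ φ ψ, innerL2 (A φ) ψ = innerL2 φ (A ψ)

/-- `A ≥ 0` on the domain of Schwartz functions. -/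
def IsPos (A : Module.End ℂ 𝓢(E, ℂ)) : Prop :=
  ∀ ψ, 0 ≤ (innerL2 ψ (A ψ)).re ∧ (innerL2 ψ (A ψ)).im = 0

/-- States on an algebra of operators with domain the Schwartz functions: the strongly positive
linear functionals that take the value `1` at the unit. -/
@[ext]
structure State (𝒜 : Subalgebra ℂ (Module.End ℂ 𝓢(E, ℂ))) where
  val : 𝒜 →ₗ[ℂ] ℂ
  map_one : val 1 = 1
  strongly_pos : ∀ A : 𝒜, IsPos (A : Module.End ℂ 𝓢(E, ℂ)) → 0 ≤ (val A).re ∧ (val A).im = 0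

/-- The value `Tr(ρ A)` at the state `ρ` of the attribute represented by the symmetric
operator `A`. -/
def State.value {𝒜 : Subalgebra ℂ (Module.End ℂ 𝓢(E, ℂ))} (ρ : State 𝒜) (A : 𝒜) : ℝ :=
  (ρ.val A).re

/-- The weak topology on the state space, generated by the functions `ρ ↦ Tr(ρ A)`. -/
instance {𝒜 : Subalgebra ℂ (Module.End ℂ 𝓢(E, ℂ))} : TopologicalSpace (State 𝒜) :=
  TopologicalSpace.induced (fun ρ => (fun A : 𝒜 => ρ.val A)) inferInstance

/-- The qr-number value `a|_W` of the attribute `A` at the condition `W`: the function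
`ρ ↦ Tr(ρ A)` on `W`. Here, and below, `W` may be any set of states. -/
def qrValue {𝒜 : Subalgebra ℂ (Module.End ℂ 𝓢(E, ℂ))} (A : 𝒜) (W : Set (State 𝒜)) : W → ℝ :=
  fun ρ => (ρ : State 𝒜).value A

end Operators

/-! ### One particle on the line, and two such particles -/

/-- The algebra of attributes of one particle on the line: generated by `Q` and `P` on `𝓢(ℝ)`. -/
def particleAlgebra (ħ : ℝ) : Subalgebra ℂ (Module.End ℂ 𝓢(ℝ, ℂ)) :=
  Algebra.adjoin ℂ {position (ContinuousLinearMap.id ℝ ℝ), momentum ħ (1 : ℝ)}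

/-- `Q` as an element of the one-particle algebra. -/
def opQ (ħ : ℝ) : particleAlgebra ħ :=
  ⟨position (ContinuousLinearMap.id ℝ ℝ), Algebra.subset_adjoin (by simp)⟩

/-- `P` as an element of the one-particle algebra. -/
def opP (ħ : ℝ) : particleAlgebra ħ :=
  ⟨momentum ħ (1 : ℝ), Algebra.subset_adjoin (by simp)⟩

/-- The coordinate of particle `j` in the two-particle configuration space `ℝ × ℝ`;
`j = 0` is the first particle, `j = 1` the second. -/
def coord : Fin 2 → (ℝ × ℝ →L[ℝ] ℝ)
  | 0 => ContinuousLinearMap.fst ℝ ℝ ℝ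
  | 1 => ContinuousLinearMap.snd ℝ ℝ ℝ

/-- The axis of particle `j` in the two-particle configuration space. -/
def axis : Fin 2 → (ℝ →L[ℝ] ℝ × ℝ)
  | 0 => ContinuousLinearMap.inl ℝ ℝ ℝ
  | 1 => ContinuousLinearMap.inr ℝ ℝ ℝ

/-- The algebra of attributes of the two-particle system: generated by `Q₁, P₁, Q₂, P₂`
on `𝓢(ℝ²)`. -/
def jointAlgebra (ħ : ℝ) : Subalgebra ℂ (Module.End ℂ 𝓢(ℝ × ℝ, ℂ)) :=
  Algebra.adjoin ℂ
    (Set.range (fun j => position (coord j)) ∪ Set.range (fun j => momentum ħ (axis j 1)))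

/-- The point of configuration space where particle `j` is at `x` and the other one at `y`. -/
def place (j : Fin 2) (y x : ℝ) : ℝ × ℝ := axis j x + axis (1 - j) y

theorem place_zero (y x : ℝ) : place 0 y x = (x, y) := by
  simp [place, axis]

theorem place_one (y x : ℝ) : place 1 y x = (y, x) := by
  simp [place, axis]

theorem place_temperate (j : Fin 2) (y : ℝ) : (place j y).HasTemperateGrowth :=
  (axis j).hasTemperateGrowth.add (Function.HasTemperateGrowth.const _)

theorem place_upper (j : Fin 2) (y : ℝ) :
    ∃ (k : ℕ) (C : ℝ), ∀ x, ‖x‖ ≤ C * (1 + ‖place j y x‖) ^ k := by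
  refine ⟨1, 1, fun x => ?_⟩
  have h : ‖x‖ ≤ ‖place j y x‖ := by
    fin_cases j
    · simp [place_zero]
    · simp [place_one]
  linarith

/-- The one-particle wave function obtained from `ψ` by fixing the other particle at `y`. -/
def slice (j : Fin 2) (y : ℝ) : 𝓢(ℝ × ℝ, ℂ) →L[ℂ] 𝓢(ℝ, ℂ) :=
  SchwartzMap.compCLM ℂ (place_temperate j y) (place_upper j y)

theorem slice_apply (j : Fin 2) (y x : ℝ) (ψ : 𝓢(ℝ × ℝ, ℂ)) :
    slice j y ψ x = ψ (place j y x) := rfl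

/-- `C` is the amplification of the one-particle operator `A` to the two-particle system:
`C = A ⊗ I` for `j = 0` and `C = I ⊗ A` for `j = 1`. That is, `C` acts by `A` on the variable of
particle `j`, with the variable of the other particle held fixed. -/
def IsAmpl (j : Fin 2) (A : Module.End ℂ 𝓢(ℝ, ℂ)) (C : Module.End ℂ 𝓢(ℝ × ℝ, ℂ)) : Prop :=
  ∀ ψ y, slice j y (C ψ) = A (slice j y ψ)

theorem IsAmpl.unique {j : Fin 2} {A : Module.End ℂ 𝓢(ℝ, ℂ)}
    {C C' : Module.End ℂ 𝓢(ℝ × ℝ, ℂ)} (h : IsAmpl j A C) (h' : IsAmpl j A C') : C = C' := by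
  refine LinearMap.ext fun ψ => SchwartzMap.ext fun z => ?_
  have key : ∀ y x, C ψ (place j y x) = C' ψ (place j y x) := fun y x => by
    rw [← slice_apply, ← slice_apply, h ψ y, h' ψ y]
  fin_cases j
  · simpa [place_zero] using key z.2 z.1
  · simpa [place_one] using key z.1 z.2

theorem isAmpl_position (j : Fin 2) :
    IsAmpl j (position (ContinuousLinearMap.id ℝ ℝ)) (position (coord j)) := by
  intro ψ y
  ext x
  rw [slice_apply, position_apply, position_apply, slice_apply]
  fin_cases j
  · simp [place_zero, coord]
  · simp [place_one, coord]

theorem isAmpl_momentum (ħ : ℝ) (j : Fin 2) :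
    IsAmpl j (momentum ħ (1 : ℝ)) (momentum ħ (axis j 1)) := by
  intro ψ y
  ext x
  rw [slice_apply, momentum_apply, momentum_apply]
  congr 1
  unfold lineDeriv
  congr 1
  funext t
  rw [slice_apply]
  congr 1
  simp only [place, map_add, map_smul]
  abel

theorem exists_ampl (ħ : ℝ) (j : Fin 2) (A : particleAlgebra ħ) :
    ∃ C : jointAlgebra ħ, IsAmpl j A C := by
  obtain ⟨A, hA⟩ := A
  induction hA using Algebra.adjoin_induction with
  | mem x hx =>
    rcases hx with rfl | rfl
    · exact ⟨⟨position (coord j), Algebra.subset_adjoin (Or.inl ⟨j, rfl⟩)⟩, isAmpl_position j⟩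
    · exact ⟨⟨momentum ħ (axis j 1), Algebra.subset_adjoin (Or.inr ⟨j, rfl⟩)⟩,
        isAmpl_momentum ħ j⟩
  | algebraMap c =>
    refine ⟨algebraMap ℂ _ c, fun ψ y => ?_⟩
    simp [Module.algebraMap_end_apply]
  | add a b _ _ iha ihb =>
    obtain ⟨C, hC⟩ := iha
    obtain ⟨D, hD⟩ := ihb
    refine ⟨C + D, fun ψ y => ?_⟩
    have h1 := hC ψ y
    have h2 := hD ψ y
    simp_all
  | mul a b _ _ iha ihb =>
    obtain ⟨C, hC⟩ := iha
    obtain ⟨D, hD⟩ := ihb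
    refine ⟨C * D, fun ψ y => ?_⟩
    have h1 := hC ((D : Module.End ℂ 𝓢(ℝ × ℝ, ℂ)) ψ) y
    have h2 := hD ψ y
    simp_all

/-- The embedding of the one-particle algebra into the two-particle algebra:
`ampl ħ 0 A = A ⊗ I` and `ampl ħ 1 B = I ⊗ B`. -/
def ampl (ħ : ℝ) (j : Fin 2) : particleAlgebra ħ →ₗ[ℂ] jointAlgebra ħ where
  toFun A := (exists_ampl ħ j A).choose
  map_add' A B := by
    refine Subtype.ext (IsAmpl.unique (exists_ampl ħ j (A + B)).choose_spec fun ψ y => ?_)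
    have h1 := (exists_ampl ħ j A).choose_spec ψ y
    have h2 := (exists_ampl ħ j B).choose_spec ψ y
    simp [h1, h2]
  map_smul' c A := by
    refine Subtype.ext (IsAmpl.unique (exists_ampl ħ j (c • A)).choose_spec fun ψ y => ?_)
    have h1 := (exists_ampl ħ j A).choose_spec ψ y
    simp [h1]

theorem isAmpl_ampl (ħ : ℝ) (j : Fin 2) (A : particleAlgebra ħ) : IsAmpl j A (ampl ħ j A) :=
  (exists_ampl ħ j A).choose_spec

theorem ampl_one (ħ : ℝ) (j : Fin 2) : ampl ħ j 1 = 1 :=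
  Subtype.ext (IsAmpl.unique (isAmpl_ampl ħ j 1) fun ψ y => by simp)

/-- `A ⊗ B` as an element of the two-particle algebra. -/
def tensor {ħ : ℝ} (A B : particleAlgebra ħ) : jointAlgebra ħ := ampl ħ 0 A * ampl ħ 1 B

theorem isPos_ampl {ħ : ℝ} (j : Fin 2) (A : particleAlgebra ħ)
    (hA : IsPos (A : Module.End ℂ 𝓢(ℝ, ℂ))) :
    IsPos (ampl ħ j A : Module.End ℂ 𝓢(ℝ × ℝ, ℂ)) := by
  intro ψ
  set C : Module.End ℂ 𝓢(ℝ × ℝ, ℂ) := (ampl ħ j A : Module.End ℂ 𝓢(ℝ × ℝ, ℂ))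
  have hint : Integrable (fun z : ℝ × ℝ => inner ℂ (ψ z) (C ψ z)) :=
    by
    have h := L2.integrable_inner (𝕜 := ℂ) (ψ.toLp 2 (volume : Measure (ℝ × ℝ)))
      ((C ψ).toLp 2 (volume : Measure (ℝ × ℝ)))
    refine h.congr ?_
    filter_upwards [ψ.coeFn_toLp 2 volume, (C ψ).coeFn_toLp 2 volume] with z h1 h2
    rw [h1, h2]
  have hs : ∀ y, (∫ x, inner ℂ (ψ (place j y x)) (C ψ (place j y x)))
      = innerL2 (slice j y ψ) ((A : Module.End ℂ 𝓢(ℝ, ℂ)) (slice j y ψ)) := fun y => by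
    rw [innerL2_eq_integral, ← isAmpl_ampl ħ j A ψ y]
    rfl
  have hfub : innerL2 ψ (C ψ)
      = ∫ y, innerL2 (slice j y ψ) ((A : Module.End ℂ 𝓢(ℝ, ℂ)) (slice j y ψ)) := by
    rw [innerL2_eq_integral]
    simp_rw [← hs]
    fin_cases j
    · simp only [place_zero, Fin.zero_eta]
      exact integral_prod_symm _ hint
    · simp only [place_one, Fin.mk_one]
      exact integral_prod _ hint
  have hreal : (∫ y, innerL2 (slice j y ψ) ((A : Module.End ℂ 𝓢(ℝ, ℂ)) (slice j y ψ)))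
      = ((∫ y, (innerL2 (slice j y ψ) ((A : Module.End ℂ 𝓢(ℝ, ℂ)) (slice j y ψ))).re : ℝ) : ℂ) := by
    rw [← integral_complex_ofReal]
    refine integral_congr_ae (Filter.Eventually.of_forall fun y => ?_)
    exact Complex.ext rfl (hA (slice j y ψ)).2
  rw [hfub, hreal]
  exact ⟨integral_nonneg fun y => (hA (slice j y ψ)).1, rfl⟩

/-- Position `Q_j` of particle `j` in the two-particle system: `Q ⊗ I` for `j = 0` and `I ⊗ Q`
for `j = 1`. -/
abbrev jointQ (ħ : ℝ) (j : Fin 2) : jointAlgebra ħ := ampl ħ j (opQ ħ)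

/-- Momentum `P_j` of particle `j` in the two-particle system. -/
abbrev jointP (ħ : ℝ) (j : Fin 2) : jointAlgebra ħ := ampl ħ j (opP ħ)

theorem coe_jointQ (ħ : ℝ) (j : Fin 2) :
    (jointQ ħ j : Module.End ℂ 𝓢(ℝ × ℝ, ℂ)) = position (coord j) :=
  IsAmpl.unique (isAmpl_ampl ħ j (opQ ħ)) (isAmpl_position j)

theorem coe_jointP (ħ : ℝ) (j : Fin 2) :
    (jointP ħ j : Module.End ℂ 𝓢(ℝ × ℝ, ℂ)) = momentum ħ (axis j 1) :=
  IsAmpl.unique (isAmpl_ampl ħ j (opP ħ)) (isAmpl_momentum ħ j)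

/-- States of one particle. -/
abbrev ParticleState (ħ : ℝ) := State (particleAlgebra ħ)

/-- States of the two-particle system. -/
abbrev JointState (ħ : ℝ) := State (jointAlgebra ħ)

/-- The reduced state of particle `j` (partial trace over the other particle):
`Tr(ρ̃₁ A) = Tr(ρ (A ⊗ I))`, `Tr(ρ̃₂ B) = Tr(ρ (I ⊗ B))`. The reduced condition of a condition
`W` consists of the reduced states of its elements. -/
def reduce {ħ : ℝ} (j : Fin 2) (ρ : JointState ħ) : ParticleState ħ where
  val := ρ.val ∘ₗ ampl ħ j
  map_one := by simp [ampl_one, ρ.map_one]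
  strongly_pos A hA := ρ.strongly_pos _ (isPos_ampl j A hA)

/-- A product condition: for every pair of attributes `A` of the first and `B` of the second
particle, the qr-number value of `A ⊗ B` at `W` is the product of the qr-number values of `A` and
`B` at the reduced conditions. -/
def IsProductCondition {ħ : ℝ} (W : Set (JointState ħ)) : Prop :=
  ∀ A B : particleAlgebra ħ, IsSymm (A : Module.End ℂ 𝓢(ℝ, ℂ)) →
    IsSymm (B : Module.End ℂ 𝓢(ℝ, ℂ)) →
    ∀ ρ ∈ W, ρ.value (tensor A B) = (reduce 0 ρ).value A * (reduce 1 ρ).value B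

/-- An entangled condition is one that is not a product condition. -/
def IsEntangled {ħ : ℝ} (W : Set (JointState ħ)) : Prop := ¬ IsProductCondition W

/-! ### Dynamics -/

/-- `U` is the unitary evolution `U_t = exp(-i t H / ħ)` on the Schwartz domain: a one-parameter
group of isometric bijections that solves the Schrödinger equation `iħ dψ/dt = Hψ` in `L²`. -/
structure IsUnitaryEvolution (ħ : ℝ) (H : Module.End ℂ 𝓢(ℝ × ℝ, ℂ))
    (U : ℝ → (𝓢(ℝ × ℝ, ℂ) ≃ₗ[ℂ] 𝓢(ℝ × ℝ, ℂ))) : Prop where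
  zero : ∀ ψ, U 0 ψ = ψ
  add : ∀ s t ψ, U (s + t) ψ = U s (U t ψ)
  isometric : ∀ t φ ψ, innerL2 (U t φ) (U t ψ) = innerL2 φ ψ
  schrodinger : ∀ ψ t, HasDerivAt (fun s => (U s ψ).toLp 2 (volume : Measure (ℝ × ℝ)))
    (((-(I / (ħ : ℂ))) • H (U t ψ)).toLp 2 (volume : Measure (ℝ × ℝ))) t

/-- `r t ρ` is the state `ρ_t = U_t ρ U_t*` into which `ρ` evolves under the Hamiltonian `H`:
`U_t* A U_t` belongs to the algebra for every attribute `A`, and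
`Tr(ρ_t A) = Tr(ρ U_t* A U_t)`. -/
def IsStateEvolution (ħ : ℝ) (H : jointAlgebra ħ)
    (r : ℝ → JointState ħ → JointState ħ) : Prop :=
  ∃ U, IsUnitaryEvolution ħ (H : Module.End ℂ 𝓢(ℝ × ℝ, ℂ)) U ∧
    ∀ t ρ (A : jointAlgebra ħ), ∃ B : jointAlgebra ħ,
      (∀ ψ, (B : Module.End ℂ 𝓢(ℝ × ℝ, ℂ)) ψ
        = (U t).symm ((A : Module.End ℂ 𝓢(ℝ × ℝ, ℂ)) (U t ψ))) ∧
      (r t ρ).val A = ρ.val B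

/-- The Hamiltonian operator `γ Q₁ ⊗ P₂` of the von Neumann interaction. -/
def vonNeumannOp (ħ γ : ℝ) : jointAlgebra ħ := (γ : ℂ) • tensor (opQ ħ) (opP ħ)

/-- The qr-number Hamiltonian `h(q₁, p₁, q₂, p₂) = γ q₁ p₂` of the von Neumann interaction. -/
def vonNeumannFun (γ : ℝ) : ℝ → ℝ → ℝ → ℝ → ℝ := fun q₁ _ _ p₂ => γ * q₁ * p₂

/-- Hamilton's equations in qr-numbers during `[0, T]`, for two particles on the line with
Hamiltonian function `h(q₁, p₁, q₂, p₂)`. The qr-numbers are real functions on a condition `X`. -/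
structure IsQRMotion {X : Type*} (h : ℝ → ℝ → ℝ → ℝ → ℝ) (T : ℝ)
    (q₁ p₁ q₂ p₂ : ℝ → X → ℝ) : Prop where
  q₁_eq : ∀ t ∈ Set.Icc 0 T, ∀ ρ, HasDerivWithinAt (fun s => q₁ s ρ)
    (deriv (fun u => h (q₁ t ρ) u (q₂ t ρ) (p₂ t ρ)) (p₁ t ρ)) (Set.Icc 0 T) t
  p₁_eq : ∀ t ∈ Set.Icc 0 T, ∀ ρ, HasDerivWithinAt (fun s => p₁ s ρ)
    (-deriv (fun u => h u (p₁ t ρ) (q₂ t ρ) (p₂ t ρ)) (q₁ t ρ)) (Set.Icc 0 T) t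
  q₂_eq : ∀ t ∈ Set.Icc 0 T, ∀ ρ, HasDerivWithinAt (fun s => q₂ s ρ)
    (deriv (fun u => h (q₁ t ρ) (p₁ t ρ) (q₂ t ρ) u) (p₂ t ρ)) (Set.Icc 0 T) t
  p₂_eq : ∀ t ∈ Set.Icc 0 T, ∀ ρ, HasDerivWithinAt (fun s => p₂ s ρ)
    (-deriv (fun u => h (q₁ t ρ) (p₁ t ρ) u (p₂ t ρ)) (q₂ t ρ)) (Set.Icc 0 T) t

end QR

end

/-!
The Hamiltonian `γ Q₁P₂` acts as `-iħγ x ∂_y`, so its Schrödinger equation is the transport equation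
`∂ψ/∂t = -γ x ∂_y ψ`, and the evolution is `U_t ψ(x, y) = ψ(x, y - γ t x)`: composition with a shear
of the plane. The shear is linear, so `U_t` preserves Schwartz functions, and measure preserving,
so `U_t` is isometric. The time derivative exists in `L²` and not merely pointwise because the
Taylor remainder is at most `h²` times a fixed rapidly decreasing function
(`exists_taylor_bound`, `hasDerivAt_shearOp_zero`).

A unitary evolution is determined by its Schrödinger equation: its own isometry makes the
generator skew-symmetric, hence `⟨U_t φ, V_t ψ⟩` is constant in `t` for any two evolutions, and
`‖U_t ψ - V_t ψ‖ = 0` (`IsUnitaryEvolution.unique`).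

Conjugation by the shear sends the generators `Q₁, P₁, Q₂, P₂` of the algebra to
`Q₁, P₁ - cP₂, Q₂ + cQ₁, P₂` with `c = γ t`. It therefore preserves the algebra, and by duality it acts
on states continuously with a continuous inverse (`isHomeomorph_evolve`). These formulas are also
the solutions of Hamilton's equations for `h = γ q₁p₂`.

Finally `Q₁Q₂` is sent to `Q₁Q₂ + cQ₁²`. For a product state this makes the covariance of the
two positions equal to `c` times the variance of `Q` in the first reduced state, and this variance is
positive by the uncertainty relation (`variance_pos`), which holds for all strongly positive
functionals because `(P + is(Q - q))† (P + is(Q - q)) ≥ 0` for all real `s`.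
-/

noncomputable section

namespace QR

/-! ### The inner product of Schwartz functions -/

section Inner

variable {E : Type*} [NormedAddCommGroup E] [NormedSpace ℝ E]
  [MeasureSpace E] [BorelSpace E] [(volume : Measure E).HasTemperateGrowth]

theorem innerL2_add_left (φ₁ φ₂ ψ : 𝓢(E, ℂ)) :
    innerL2 (φ₁ + φ₂) ψ = innerL2 φ₁ ψ + innerL2 φ₂ ψ := by
  have h := (SchwartzMap.toLpCLM ℂ ℂ 2 (volume : Measure E)).map_add φ₁ φ₂
  simp only [SchwartzMap.toLpCLM_apply] at h
  rw [innerL2, h, inner_add_left]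
  rfl

theorem innerL2_add_right (φ ψ₁ ψ₂ : 𝓢(E, ℂ)) :
    innerL2 φ (ψ₁ + ψ₂) = innerL2 φ ψ₁ + innerL2 φ ψ₂ := by
  have h := (SchwartzMap.toLpCLM ℂ ℂ 2 (volume : Measure E)).map_add ψ₁ ψ₂
  simp only [SchwartzMap.toLpCLM_apply] at h
  rw [innerL2, h, inner_add_right]
  rfl

theorem innerL2_smul_left (c : ℂ) (φ ψ : 𝓢(E, ℂ)) :
    innerL2 (c • φ) ψ = star c * innerL2 φ ψ := by
  have h := (SchwartzMap.toLpCLM ℂ ℂ 2 (volume : Measure E)).map_smul c φ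
  simp only [SchwartzMap.toLpCLM_apply] at h
  rw [innerL2, h, inner_smul_left]
  rfl

theorem innerL2_smul_right (c : ℂ) (φ ψ : 𝓢(E, ℂ)) :
    innerL2 φ (c • ψ) = c * innerL2 φ ψ := by
  have h := (SchwartzMap.toLpCLM ℂ ℂ 2 (volume : Measure E)).map_smul c ψ
  simp only [SchwartzMap.toLpCLM_apply] at h
  rw [innerL2, h, inner_smul_right]
  rfl

/-- An operator of the form `L†L` is positive. -/
theorem isPos_mul_of_adjoint {L M : Module.End ℂ 𝓢(E, ℂ)}
    (h : ∀ φ ψ, innerL2 (L φ) ψ = innerL2 φ (M ψ)) : IsPos (M * L) := by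
  intro ψ
  rw [Module.End.mul_apply, ← h, innerL2]
  exact ⟨inner_self_nonneg (𝕜 := ℂ), inner_self_im (𝕜 := ℂ) _⟩

theorem isSymm_position [FiniteDimensional ℝ E] (ℓ : E →L[ℝ] ℝ) : IsSymm (position ℓ) := by
  intro φ ψ
  rw [innerL2_eq_integral, innerL2_eq_integral]
  congr 1
  funext x
  rw [position_apply, position_apply]
  simp only [RCLike.inner_apply, map_mul, conj_ofReal]
  ring

theorem isSymm_momentum [FiniteDimensional ℝ E] [(volume : Measure E).IsAddHaarMeasure]
    (ħ : ℝ) (v : E) : IsSymm (momentum ħ v) := by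
  intro φ ψ
  have h := SchwartzMap.integral_bilinear_lineDerivOp_right_eq_neg_left (μ := volume) φ ψ
    ((ContinuousLinearMap.mul ℝ ℂ).comp (conjCLE : ℂ →L[ℝ] ℂ)) v
  simp only [SchwartzMap.lineDerivOp_apply, ContinuousLinearMap.comp_apply,
    ContinuousLinearMap.mul_apply', ContinuousLinearEquiv.coe_coe, conjCLE_apply] at h
  rw [innerL2_eq_integral, innerL2_eq_integral]
  simp only [momentum_apply, RCLike.inner_apply]
  calc _ = ∫ x, (I * ħ) * ((starRingEnd ℂ) (lineDeriv ℝ φ x v) * ψ x) := by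
        congr 1; funext x; simp; ring
    _ = ∫ x, (-(I * ħ)) * ((starRingEnd ℂ) (φ x) * lineDeriv ℝ ψ x v) := by
        rw [integral_const_mul, integral_const_mul, h]; ring
    _ = _ := by
        congr 1; funext x; ring

end Inner

/-! ### The uncertainty relation -/

theorem opP_mul_opQ (ħ : ℝ) : opP ħ * opQ ħ = opQ ħ * opP ħ - (I * (ħ : ℂ)) • 1 := by
  refine Subtype.ext (LinearMap.ext fun ψ => SchwartzMap.ext fun x => ?_)
  change momentum ħ (1 : ℝ) (position (ContinuousLinearMap.id ℝ ℝ) ψ) x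
    = position (ContinuousLinearMap.id ℝ ℝ) (momentum ħ (1 : ℝ) ψ) x - (I * (ħ : ℂ)) * ψ x
  have hf : (fun y : ℝ => position (ContinuousLinearMap.id ℝ ℝ) ψ y)
      = fun y : ℝ => (y : ℂ) * ψ y := by
    funext y; rw [position_apply]; rfl
  have hd : HasDerivAt (fun y : ℝ => (y : ℂ) * ψ y) (1 * ψ x + (x : ℂ) * deriv ψ x) x :=
    (ofRealCLM.hasDerivAt (x := x)).mul ψ.differentiableAt.hasDerivAt
  have h1 : lineDeriv ℝ (position (ContinuousLinearMap.id ℝ ℝ) ψ) x 1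
      = ψ x + (x : ℂ) * deriv ψ x := by
    change lineDeriv ℝ (fun y : ℝ => position (ContinuousLinearMap.id ℝ ℝ) ψ y) x 1 = _
    rw [hf, hd.differentiableAt.lineDeriv_eq_fderiv, fderiv_apply_one_eq_deriv, hd.deriv, one_mul]
  rw [momentum_apply, position_apply, momentum_apply, h1,
    ψ.differentiableAt.lineDeriv_eq_fderiv, fderiv_apply_one_eq_deriv]
  simp
  ring

/-- The operator `(P + is(Q - q))† (P + is(Q - q))`, expanded with the commutation relation. -/
theorem momentum_position_square_eq (ħ s q : ℝ) :
    (opP ħ - (I * s : ℂ) • (opQ ħ - (q : ℂ) • 1)) * (opP ħ + (I * s : ℂ) • (opQ ħ - (q : ℂ) • 1))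
      = opP ħ * opP ħ + ((s ^ 2 : ℝ) : ℂ) • (opQ ħ * opQ ħ)
        - ((2 * q * s ^ 2 : ℝ) : ℂ) • opQ ħ + ((s ^ 2 * q ^ 2 + s * ħ : ℝ) : ℂ) • 1 := by
  simp only [sub_mul, mul_add, mul_sub, smul_mul_assoc, mul_smul_comm, smul_sub, one_mul, mul_one,
    opP_mul_opQ, smul_smul]
  push_cast
  match_scalars <;> ring_nf <;> simp only [I_sq] <;> ring

/-- `(P + is(Q - q))† (P + is(Q - q)) ≥ 0`. -/
theorem isPos_momentum_position_square (ħ s q : ℝ) :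
    IsPos (((opP ħ - (I * s : ℂ) • (opQ ħ - (q : ℂ) • 1)) *
      (opP ħ + (I * s : ℂ) • (opQ ħ - (q : ℂ) • 1)) : particleAlgebra ħ) :
      Module.End ℂ 𝓢(ℝ, ℂ)) := by
  refine isPos_mul_of_adjoint fun φ ψ => ?_
  have hP : ∀ φ ψ, innerL2 ((opP ħ : Module.End ℂ 𝓢(ℝ, ℂ)) φ) ψ
    = innerL2 φ ((opP ħ : Module.End ℂ 𝓢(ℝ, ℂ)) ψ) := isSymm_momentum ħ 1
  have hQ : ∀ φ ψ, innerL2 ((opQ ħ : Module.End ℂ 𝓢(ℝ, ℂ)) φ) ψ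
    = innerL2 φ ((opQ ħ : Module.End ℂ 𝓢(ℝ, ℂ)) ψ) := isSymm_position _
  simp [-Complex.coe_smul, sub_eq_add_neg, innerL2_add_left, innerL2_add_right, innerL2_smul_left,
    innerL2_smul_right, hP, hQ, ← neg_smul]
  ring

/-- The position of a particle has nonzero variance in every state: this is the uncertainty
relation, in the qualitative form that needs no bound on the variance of the momentum. -/
theorem variance_pos {ħ : ℝ} (hħ : 0 < ħ) (σ : ParticleState ħ) :
    σ.value (opQ ħ) ^ 2 < σ.value (opQ ħ * opQ ħ) := by
  set q := σ.value (opQ ħ)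
  set p := σ.value (opP ħ * opP ħ)
  set v := σ.value (opQ ħ * opQ ħ)
  have key : ∀ s : ℝ, 0 ≤ p + s ^ 2 * (v - q ^ 2) + s * ħ := fun s => by
    have h := (σ.strongly_pos _ (isPos_momentum_position_square ħ s q)).1
    rw [momentum_position_square_eq] at h
    simp only [map_add, map_sub, map_smul, σ.map_one, smul_eq_mul, add_re, sub_re, re_ofReal_mul,
      one_re] at h
    change 0 ≤ p + s ^ 2 * v - 2 * q * s ^ 2 * q + (s ^ 2 * q ^ 2 + s * ħ) * 1 at h
    linarith
  by_contra hneg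
  -- without variance the expression in `key` is affine in `s`, and negative for this `s`
  have h := key (-(p + 1) / ħ)
  have h1 : -(p + 1) / ħ * ħ = -(p + 1) := by field_simp
  nlinarith [mul_nonneg (sq_nonneg (-(p + 1) / ħ)) (sub_nonneg.2 (not_lt.1 hneg))]

/-! ### The shear flow of the configuration space -/

/-- The shear `(x, y) ↦ (x, y - c x)` of the two-particle configuration space. -/
def shear (c : ℝ) : (ℝ × ℝ) ≃L[ℝ] (ℝ × ℝ) :=
  ContinuousLinearEquiv.equivOfInverse
    ((ContinuousLinearMap.fst ℝ ℝ ℝ).prod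
      (ContinuousLinearMap.snd ℝ ℝ ℝ - c • ContinuousLinearMap.fst ℝ ℝ ℝ))
    ((ContinuousLinearMap.fst ℝ ℝ ℝ).prod
      (ContinuousLinearMap.snd ℝ ℝ ℝ + c • ContinuousLinearMap.fst ℝ ℝ ℝ))
    (fun z => by simp) (fun z => by simp)

@[simp] theorem shear_apply (c : ℝ) (z : ℝ × ℝ) : shear c z = (z.1, z.2 - c * z.1) := rfl

theorem measurePreserving_shear (c : ℝ) : MeasurePreserving (shear c) volume volume := by
  refine MeasurePreserving.skew_product (MeasurePreserving.id volume)
    (g := fun x y => y - c * x) (by fun_prop) (Filter.Eventually.of_forall fun x => ?_)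
  exact map_sub_right_eq_self volume (c * x)

theorem norm_le_mul_norm_shear (c : ℝ) (z : ℝ × ℝ) : ‖z‖ ≤ (1 + |c|) * ‖shear c z‖ := by
  have h1 : |z.1| ≤ ‖shear c z‖ := norm_fst_le (shear c z)
  have h2 : |z.2 - c * z.1| ≤ ‖shear c z‖ := norm_snd_le (shear c z)
  have h3 : |z.2| ≤ |z.2 - c * z.1| + |c| * |z.1| := by
    rw [← abs_mul]; simpa using abs_add_le (z.2 - c * z.1) (c * z.1)
  have h4 : |c| * |z.1| ≤ |c| * ‖shear c z‖ := by gcongr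
  refine max_le ?_ ?_
  · change |z.1| ≤ _
    nlinarith [abs_nonneg c, norm_nonneg (shear c z)]
  · change |z.2| ≤ _
    linarith

/-- The operator `ψ(x, y) ↦ ψ(x, y - c x)`. -/
def shearOp (c : ℝ) : 𝓢(ℝ × ℝ, ℂ) ≃ₗ[ℂ] 𝓢(ℝ × ℝ, ℂ) :=
  LinearEquiv.ofLinearMap
    (SchwartzMap.compCLMOfContinuousLinearEquiv ℂ (shear c)).toLinearMap
    (SchwartzMap.compCLMOfContinuousLinearEquiv ℂ (shear (-c))).toLinearMap
    (by ext ψ z; simp) (by ext ψ z; simp)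

theorem shearOp_apply (c : ℝ) (ψ : 𝓢(ℝ × ℝ, ℂ)) (z : ℝ × ℝ) :
    shearOp c ψ z = ψ (shear c z) := rfl

theorem shearOp_symm (c : ℝ) : (shearOp c).symm = shearOp (-c) := by
  ext ψ z
  rfl

theorem shearOp_add (c d : ℝ) (ψ : 𝓢(ℝ × ℝ, ℂ)) :
    shearOp (c + d) ψ = shearOp c (shearOp d ψ) := by
  ext z
  simp only [shearOp_apply, shear_apply]
  congr 2
  ring

theorem innerL2_shearOp (c : ℝ) (φ ψ : 𝓢(ℝ × ℝ, ℂ)) :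
    innerL2 (shearOp c φ) (shearOp c ψ) = innerL2 φ ψ := by
  rw [innerL2_eq_integral, innerL2_eq_integral]
  exact (measurePreserving_shear c).integral_comp
    (shear c).toHomeomorph.measurableEmbedding (fun z => inner ℂ (φ z) (ψ z))

/-! ### The Schrödinger equation -/

/-- `-(i/ħ) H` for the von Neumann interaction `H`. -/
def generator (ħ γ : ℝ) : Module.End ℂ 𝓢(ℝ × ℝ, ℂ) :=
  (-(I / (ħ : ℂ))) • (vonNeumannOp ħ γ : Module.End ℂ 𝓢(ℝ × ℝ, ℂ))

theorem generator_apply {ħ : ℝ} (hħ : ħ ≠ 0) (γ : ℝ) (ψ : 𝓢(ℝ × ℝ, ℂ)) (z : ℝ × ℝ) :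
    generator ħ γ ψ z = -(γ * z.1 : ℂ) * fderiv ℝ ψ z (0, 1) := by
  have h : generator ħ γ ψ z = (-(I / (ħ : ℂ))) * ((γ : ℂ) *
      ((jointQ ħ 0 : Module.End ℂ 𝓢(ℝ × ℝ, ℂ))
        ((jointP ħ 1 : Module.End ℂ 𝓢(ℝ × ℝ, ℂ)) ψ) z)) := rfl
  have hħ' : (ħ : ℂ) ≠ 0 := ofReal_ne_zero.2 hħ
  rw [h, coe_jointQ, coe_jointP, position_apply, momentum_apply,
    ψ.differentiableAt.lineDeriv_eq_fderiv]
  simp only [coord, axis, ContinuousLinearMap.coe_fst', ContinuousLinearMap.inr_apply]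
  field_simp
  rw [I_sq]
  ring

/-- Along the flow, the wave function changes at the rate given by the generator, pointwise. -/
theorem hasDerivAt_shear {ħ : ℝ} (hħ : ħ ≠ 0) (γ : ℝ) (ψ : 𝓢(ℝ × ℝ, ℂ)) (z : ℝ × ℝ) (s : ℝ) :
    HasDerivAt (fun s => ψ (shear (γ * s) z)) (generator ħ γ ψ (shear (γ * s) z)) s := by
  have hpath : HasDerivAt (fun s : ℝ => shear (γ * s) z) ((0 : ℝ), -(γ * z.1)) s := by
    refine (hasDerivAt_const s z.1).prodMk ?_
    have := (((hasDerivAt_id s).const_mul γ).mul_const z.1).const_sub z.2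
    simpa using this
  have h := (ψ.differentiableAt (x := shear (γ * s) z)).hasFDerivAt.comp_hasDerivAt s hpath
  refine h.congr_deriv ?_
  have hv : ((0 : ℝ), -(γ * z.1)) = (-(γ * z.1)) • ((0 : ℝ), (1 : ℝ)) := by simp
  rw [generator_apply hħ, hv, map_smul, real_smul]
  simp

/-- A Schwartz function decays rapidly along the flow, uniformly for bounded times, because the
shears by bounded amounts are uniformly bounded below. -/
theorem exists_decay_along_shear (χ : 𝓢(ℝ × ℝ, ℂ)) (γ : ℝ) (k : ℕ) :
    ∃ C, 0 ≤ C ∧ ∀ s ∈ Set.Icc (-1 : ℝ) 1, ∀ z,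
      ‖χ (shear (γ * s) z)‖ ≤ C * (1 + ‖z‖) ^ (-k : ℝ) := by
  set C₀ := 2 ^ k * ((Finset.Iic (k, 0)).sup fun m => SchwartzMap.seminorm ℂ m.1 m.2) χ
  have hdec : ∀ w, (1 + ‖w‖) ^ k * ‖χ w‖ ≤ C₀ := fun w => by
    simpa using SchwartzMap.one_add_le_sup_seminorm_apply (𝕜 := ℂ) (m := (k, 0)) le_rfl le_rfl χ w
  refine ⟨(1 + |γ|) ^ k * C₀, mul_nonneg (by positivity)
    (le_trans (by positivity) (hdec 0)), fun s hs z => ?_⟩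
  set w := shear (γ * s) z with hw
  have hz : 1 + ‖z‖ ≤ (1 + |γ|) * (1 + ‖w‖) := by
    have h1 := norm_le_mul_norm_shear (γ * s) z
    have h2 : |γ * s| ≤ |γ| := by
      rw [abs_mul]
      exact mul_le_of_le_one_right (abs_nonneg γ) (abs_le.2 hs)
    have h3 : |γ * s| * ‖w‖ ≤ |γ| * ‖w‖ := by gcongr
    rw [← hw] at h1
    nlinarith [abs_nonneg γ]
  have hpos : 0 < (1 + ‖z‖) ^ k := by positivity
  rw [Real.rpow_neg (by positivity), Real.rpow_natCast, ← div_eq_mul_inv, le_div_iff₀ hpos]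
  calc ‖χ w‖ * (1 + ‖z‖) ^ k ≤ ‖χ w‖ * ((1 + |γ|) * (1 + ‖w‖)) ^ k := by gcongr
    _ = (1 + |γ|) ^ k * ((1 + ‖w‖) ^ k * ‖χ w‖) := by rw [mul_pow]; ring
    _ ≤ _ := by gcongr; exact hdec w

/-- First-order Taylor estimate along the flow. The remainder has the second derivative as its
source; since the generator commutes with the flow, this is again a Schwartz function, so that the
majorant can be taken in `L²`. -/
theorem exists_taylor_bound {ħ : ℝ} (hħ : ħ ≠ 0) (γ : ℝ) (ψ : 𝓢(ℝ × ℝ, ℂ)) (k : ℕ) :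
    ∃ C, 0 ≤ C ∧ ∀ h ∈ Set.Icc (-1 : ℝ) 1, ∀ z,
      ‖ψ (shear (γ * h) z) - ψ z - h • generator ħ γ ψ z‖ ≤
        C * h ^ 2 * (1 + ‖z‖) ^ (-k : ℝ) := by
  obtain ⟨C, hC, hb⟩ := exists_decay_along_shear (generator ħ γ (generator ħ γ ψ)) γ k
  refine ⟨C, hC, fun h hh z => ?_⟩
  set M := C * (1 + ‖z‖) ^ (-k : ℝ) with hM
  have hM0 : 0 ≤ M := by positivity
  have hmem : ∀ s ∈ Metric.closedBall (0 : ℝ) |h|, s ∈ Set.Icc (-1 : ℝ) 1 := fun s hs => by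
    rw [mem_closedBall_zero_iff, Real.norm_eq_abs] at hs
    exact abs_le.1 (hs.trans (abs_le.2 hh))
  have h0 : (0 : ℝ) ∈ Metric.closedBall (0 : ℝ) |h| := by simp
  have hz : shear (γ * 0) z = z := by simp
  have hfirst : ∀ s ∈ Metric.closedBall (0 : ℝ) |h|,
      ‖generator ħ γ ψ (shear (γ * s) z) - generator ħ γ ψ z‖ ≤ M * |h| := fun s hs => by
    have := (convex_closedBall (0 : ℝ) |h|).norm_image_sub_le_of_norm_hasDerivWithin_le
      (fun u _ => (hasDerivAt_shear hħ γ (generator ħ γ ψ) z u).hasDerivWithinAt)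
      (fun u hu => hb u (hmem u hu) z) h0 hs
    rw [hz, sub_zero] at this
    exact this.trans (by gcongr; simpa using hs)
  have := (convex_closedBall (0 : ℝ) |h|).norm_image_sub_le_of_norm_hasDerivWithin_le
      (f := fun u => ψ (shear (γ * u) z) - u • generator ħ γ ψ z)
      (fun u _ => ((hasDerivAt_shear hħ γ ψ z u).sub
        ((hasDerivAt_id u).smul_const (generator ħ γ ψ z))).hasDerivWithinAt)
      (fun u hu => by simpa using hfirst u hu) h0 (y := h) (by simp)
  simp only [hz, zero_smul, sub_zero] at this
  rw [sub_right_comm]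
  refine this.trans (le_of_eq ?_)
  rw [Real.norm_eq_abs, mul_assoc, abs_mul_abs_self, hM]
  ring

/-- The Schrödinger equation holds in `L²` at time `0`. -/
theorem hasDerivAt_shearOp_zero {ħ : ℝ} (hħ : ħ ≠ 0) (γ : ℝ) (ψ : 𝓢(ℝ × ℝ, ℂ)) :
    HasDerivAt (fun s => (shearOp (γ * s) ψ).toLp 2 (volume : Measure (ℝ × ℝ)))
      ((generator ħ γ ψ).toLp 2 (volume : Measure (ℝ × ℝ))) 0 := by
  obtain ⟨k, hk⟩ := Measure.HasTemperateGrowth.exists_eLpNorm_lt_top 2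
    (inferInstance : (volume : Measure (ℝ × ℝ)).HasTemperateGrowth)
  have hmem : MemLp (fun z : ℝ × ℝ => (1 + ‖z‖) ^ (-k : ℝ)) 2 volume :=
    ⟨((measurable_norm.const_add 1).pow_const _).aestronglyMeasurable, hk⟩
  obtain ⟨C, hC, hb⟩ := exists_taylor_bound hħ γ ψ k
  have hest : ∀ h ∈ Set.Icc (-1 : ℝ) 1,
      ‖(shearOp (γ * h) ψ).toLp 2 (volume : Measure (ℝ × ℝ)) - ψ.toLp 2 volume
        - h • (generator ħ γ ψ).toLp 2 volume‖ ≤ C * h ^ 2 * ‖hmem.toLp‖ := fun h hh => by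
    refine Lp.norm_le_mul_norm_of_ae_le_mul ?_
    filter_upwards [Lp.coeFn_sub ((shearOp (γ * h) ψ).toLp 2 (volume : Measure (ℝ × ℝ))
        - ψ.toLp 2 volume) (h • (generator ħ γ ψ).toLp 2 volume),
      Lp.coeFn_sub ((shearOp (γ * h) ψ).toLp 2 (volume : Measure (ℝ × ℝ))) (ψ.toLp 2 volume),
      Lp.coeFn_smul h ((generator ħ γ ψ).toLp 2 (volume : Measure (ℝ × ℝ))),
      (shearOp (γ * h) ψ).coeFn_toLp 2 volume, ψ.coeFn_toLp 2 volume,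
      (generator ħ γ ψ).coeFn_toLp 2 volume, hmem.coeFn_toLp] with z h1 h2 h3 h4 h5 h6 h7
    rw [h1, Pi.sub_apply, h2, Pi.sub_apply, h3, Pi.smul_apply, h4, h5, h6, h7,
      Real.norm_of_nonneg (r := (1 + ‖z‖) ^ (-k : ℝ)) (by positivity)]
    exact hb h hh z
  have hzero : shearOp (γ * 0) ψ = ψ := by
    ext z; simp [shearOp_apply]
  rw [hasDerivAt_iff_isLittleO, hzero]
  simp only [sub_zero]
  refine Asymptotics.IsBigO.trans_isLittleO (g := fun h : ℝ => h ^ 2)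
    (Asymptotics.IsBigO.of_bound (C * ‖hmem.toLp‖) ?_) ?_
  · filter_upwards [Icc_mem_nhds (show (-1 : ℝ) < 0 by norm_num) one_pos] with h hh
    refine (hest h hh).trans (le_of_eq ?_)
    rw [Real.norm_of_nonneg (sq_nonneg h)]
    ring
  · exact Asymptotics.isLittleO_pow_id one_lt_two

theorem isUnitaryEvolution_shearOp {ħ : ℝ} (hħ : ħ ≠ 0) (γ : ℝ) :
    IsUnitaryEvolution ħ (vonNeumannOp ħ γ : Module.End ℂ 𝓢(ℝ × ℝ, ℂ))
      (fun t => shearOp (γ * t)) where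
  zero ψ := by ext z; simp [shearOp_apply]
  add s t ψ := by rw [mul_add, shearOp_add]
  isometric t := innerL2_shearOp _
  schrodinger ψ t := by
    have h := hasDerivAt_shearOp_zero hħ γ (shearOp (γ * t) ψ)
    -- the group law moves the derivative at `0` to time `t`
    rw [← sub_self t] at h
    have h' := h.comp_sub_const t t
    refine h'.congr_of_eventuallyEq (Filter.Eventually.of_forall fun s => ?_)
    simp only
    rw [← shearOp_add, mul_sub, sub_add_cancel]

/-! ### Uniqueness of the unitary evolution -/

section Uniqueness

variable {ħ : ℝ} {H : Module.End ℂ 𝓢(ℝ × ℝ, ℂ)}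
  {U V : ℝ → (𝓢(ℝ × ℝ, ℂ) ≃ₗ[ℂ] 𝓢(ℝ × ℝ, ℂ))}

theorem hasDerivAt_innerL2 (hU : IsUnitaryEvolution ħ H U) (hV : IsUnitaryEvolution ħ H V)
    (φ ψ : 𝓢(ℝ × ℝ, ℂ)) (t : ℝ) :
    HasDerivAt (fun s => innerL2 (U s φ) (V s ψ))
      (innerL2 (U t φ) ((-(I / (ħ : ℂ))) • H (V t ψ))
        + innerL2 ((-(I / (ħ : ℂ))) • H (U t φ)) (V t ψ)) t :=
  (hU.schrodinger φ t).inner ℂ (hV.schrodinger ψ t)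

/-- The generator of a unitary evolution is skew-symmetric. -/
theorem IsUnitaryEvolution.skew (hU : IsUnitaryEvolution ħ H U) (φ ψ : 𝓢(ℝ × ℝ, ℂ)) :
    innerL2 φ ((-(I / (ħ : ℂ))) • H ψ) + innerL2 ((-(I / (ħ : ℂ))) • H φ) ψ = 0 := by
  have h := hasDerivAt_innerL2 hU hU φ ψ 0
  simp only [hU.isometric, hU.zero] at h
  exact h.unique (hasDerivAt_const _ _)

/-- Any two unitary evolutions with the same Hamiltonian move inner products in the same way:
the derivative of the left side vanishes, the generator being skew-symmetric. -/
theorem innerL2_evolutions (hU : IsUnitaryEvolution ħ H U) (hV : IsUnitaryEvolution ħ H V)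
    (φ ψ : 𝓢(ℝ × ℝ, ℂ)) (t : ℝ) : innerL2 (U t φ) (V t ψ) = innerL2 φ ψ := by
  have hd : ∀ s, HasDerivAt (fun s => innerL2 (U s φ) (V s ψ)) 0 s := fun s => by
    simpa only [hU.skew] using hasDerivAt_innerL2 hU hV φ ψ s
  have h := is_const_of_deriv_eq_zero (fun s => (hd s).differentiableAt)
    (fun s => (hd s).deriv) t 0
  simpa only [hU.zero, hV.zero] using h

theorem IsUnitaryEvolution.unique (hU : IsUnitaryEvolution ħ H U)
    (hV : IsUnitaryEvolution ħ H V) : U = V := by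
  funext t
  ext1 ψ
  refine SchwartzMap.injective_toLp 2 (volume : Measure (ℝ × ℝ)) ?_
  rw [← sub_eq_zero, ← inner_self_eq_zero (𝕜 := ℂ), inner_sub_left, inner_sub_right,
    inner_sub_right]
  change innerL2 _ _ - innerL2 _ _ - (innerL2 _ _ - innerL2 _ _) = 0
  rw [hU.isometric, hV.isometric, innerL2_evolutions hU hV, innerL2_evolutions hV hU]
  ring

end Uniqueness

/-! ### The evolution of attributes and of states -/

section Heisenberg

variable {ħ : ℝ}

/-- The automorphism `A ↦ U_c⁻¹ A U_c`, where `U_c` is `shearOp c`. -/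
def conjShear (c : ℝ) : Module.End ℂ 𝓢(ℝ × ℝ, ℂ) →ₐ[ℂ] Module.End ℂ 𝓢(ℝ × ℝ, ℂ) :=
  ((shearOp c).symm.conjAlgEquiv ℂ).toAlgHom

theorem conjShear_apply (c : ℝ) (A : Module.End ℂ 𝓢(ℝ × ℝ, ℂ)) (ψ : 𝓢(ℝ × ℝ, ℂ)) :
    conjShear c A ψ = (shearOp c).symm (A (shearOp c ψ)) := rfl

theorem conjShear_apply_apply (c : ℝ) (A : Module.End ℂ 𝓢(ℝ × ℝ, ℂ)) (ψ : 𝓢(ℝ × ℝ, ℂ))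
    (z : ℝ × ℝ) : conjShear c A ψ z = A (shearOp c ψ) (shear (-c) z) := by
  rw [conjShear_apply, shearOp_symm]
  rfl

theorem lineDeriv_shearOp (c : ℝ) (ψ : 𝓢(ℝ × ℝ, ℂ)) (z v : ℝ × ℝ) :
    lineDeriv ℝ (shearOp c ψ) z v = lineDeriv ℝ ψ (shear c z) (shear c v) := by
  unfold lineDeriv
  congr 1
  funext t
  rw [shearOp_apply, map_add, map_smul]

theorem shear_shear_neg (c : ℝ) (z : ℝ × ℝ) : shear c (shear (-c) z) = z := by
  simp

theorem conjShear_position_zero (c : ℝ) :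
    conjShear c (position (coord 0)) = position (coord 0) := by
  ext ψ z
  rw [conjShear_apply_apply, position_apply, position_apply, shearOp_apply, shear_shear_neg]
  rfl

theorem conjShear_position_one (c : ℝ) :
    conjShear c (position (coord 1)) = position (coord 1) + (c : ℂ) • position (coord 0) := by
  ext ψ z
  rw [LinearMap.add_apply, LinearMap.smul_apply, _root_.add_apply, _root_.smul_apply,
    conjShear_apply_apply, position_apply, position_apply, position_apply, shearOp_apply,
    shear_shear_neg]
  simp [coord]
  ring

theorem conjShear_momentum_zero (c : ℝ) :
    conjShear c (momentum ħ (axis 0 1)) =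
      momentum ħ (axis 0 1) - (c : ℂ) • momentum ħ (axis 1 1) := by
  ext ψ z
  rw [LinearMap.sub_apply, LinearMap.smul_apply, _root_.sub_apply, _root_.smul_apply,
    conjShear_apply_apply, momentum_apply, momentum_apply, momentum_apply, lineDeriv_shearOp,
    shear_shear_neg, ψ.differentiableAt.lineDeriv_eq_fderiv,
    ψ.differentiableAt.lineDeriv_eq_fderiv, ψ.differentiableAt.lineDeriv_eq_fderiv]
  have hv : shear c (axis 0 1) = axis 0 1 - c • axis 1 1 := by simp [axis]
  rw [hv, map_sub, map_smul, real_smul, smul_eq_mul]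
  ring

theorem conjShear_momentum_one (c : ℝ) :
    conjShear c (momentum ħ (axis 1 1)) = momentum ħ (axis 1 1) := by
  ext ψ z
  rw [conjShear_apply_apply, momentum_apply, momentum_apply, lineDeriv_shearOp, shear_shear_neg]
  have hv : shear c (axis 1 1) = axis 1 1 := by simp [axis]
  rw [hv]

theorem position_mem (j : Fin 2) : position (coord j) ∈ jointAlgebra ħ :=
  Algebra.subset_adjoin (Or.inl ⟨j, rfl⟩)

theorem momentum_mem (j : Fin 2) : momentum ħ (axis j 1) ∈ jointAlgebra ħ :=
  Algebra.subset_adjoin (Or.inr ⟨j, rfl⟩)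

theorem jointAlgebra_le_comap_conjShear (c : ℝ) :
    jointAlgebra ħ ≤ (jointAlgebra ħ).comap (conjShear c) := by
  refine Algebra.adjoin_le ?_
  rintro _ (⟨j, rfl⟩ | ⟨j, rfl⟩)
  · change conjShear c (position (coord j)) ∈ jointAlgebra ħ
    fin_cases j
    · simpa only [Fin.zero_eta, conjShear_position_zero] using position_mem 0
    · simpa only [Fin.mk_one, conjShear_position_one] using
        add_mem (position_mem 1) (Subalgebra.smul_mem _ (position_mem 0) _)
  · change conjShear c (momentum ħ (axis j 1)) ∈ jointAlgebra ħ
    fin_cases j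
    · simpa only [Fin.zero_eta, conjShear_momentum_zero] using
        sub_mem (momentum_mem 0) (Subalgebra.smul_mem _ (momentum_mem 1) _)
    · simpa only [Fin.mk_one, conjShear_momentum_one] using momentum_mem 1

/-- The Heisenberg evolution `A ↦ U_c⁻¹ A U_c` of the two-particle attributes, where `U_c` is
`shearOp c`. -/
def heisenberg (ħ c : ℝ) : jointAlgebra ħ →ₐ[ℂ] jointAlgebra ħ :=
  ((conjShear c).comp (jointAlgebra ħ).val).codRestrict (jointAlgebra ħ)
    fun A => jointAlgebra_le_comap_conjShear c A.2

theorem coe_heisenberg (c : ℝ) (A : jointAlgebra ħ) :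
    (heisenberg ħ c A : Module.End ℂ 𝓢(ℝ × ℝ, ℂ)) = conjShear c A := rfl

theorem heisenberg_jointQ_zero (c : ℝ) : heisenberg ħ c (jointQ ħ 0) = jointQ ħ 0 := by
  refine Subtype.ext ?_
  rw [coe_heisenberg, coe_jointQ, conjShear_position_zero]

theorem heisenberg_jointQ_one (c : ℝ) :
    heisenberg ħ c (jointQ ħ 1) = jointQ ħ 1 + (c : ℂ) • jointQ ħ 0 := by
  refine Subtype.ext ?_
  rw [coe_heisenberg, Subalgebra.coe_add, Subalgebra.coe_smul, coe_jointQ, coe_jointQ,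
    conjShear_position_one]

theorem heisenberg_jointP_zero (c : ℝ) :
    heisenberg ħ c (jointP ħ 0) = jointP ħ 0 - (c : ℂ) • jointP ħ 1 := by
  refine Subtype.ext ?_
  rw [coe_heisenberg, Subalgebra.coe_sub, Subalgebra.coe_smul, coe_jointP, coe_jointP,
    conjShear_momentum_zero]

theorem heisenberg_jointP_one (c : ℝ) : heisenberg ħ c (jointP ħ 1) = jointP ħ 1 := by
  refine Subtype.ext ?_
  rw [coe_heisenberg, coe_jointP, conjShear_momentum_one]

theorem isPos_conjShear (c : ℝ) {A : Module.End ℂ 𝓢(ℝ × ℝ, ℂ)} (hA : IsPos A) :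
    IsPos (conjShear c A) := fun ψ => by
  rw [conjShear_apply, ← innerL2_shearOp c ψ, LinearEquiv.apply_symm_apply]
  exact hA _

/-- The state `A ↦ Tr(ρ U_c⁻¹ A U_c)`, where `U_c` is `shearOp c`. -/
def evolve (c : ℝ) (ρ : JointState ħ) : JointState ħ where
  val := ρ.val ∘ₗ (heisenberg ħ c).toLinearMap
  map_one := by simp [ρ.map_one]
  strongly_pos A hA := ρ.strongly_pos _ (isPos_conjShear c hA)

theorem evolve_val (c : ℝ) (ρ : JointState ħ) (A : jointAlgebra ħ) :
    (evolve c ρ).val A = ρ.val (heisenberg ħ c A) := rfl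

theorem evolve_zero (ρ : JointState ħ) : evolve 0 ρ = ρ := by
  refine State.ext (LinearMap.ext fun A => ?_)
  rw [evolve_val]
  congr 1
  refine Subtype.ext (LinearMap.ext fun ψ => SchwartzMap.ext fun z => ?_)
  have h : shearOp 0 ψ = ψ := by ext w; simp [shearOp_apply]
  rw [coe_heisenberg, conjShear_apply_apply, h]
  simp

theorem evolve_evolve (c d : ℝ) (ρ : JointState ħ) :
    evolve c (evolve d ρ) = evolve (c + d) ρ := by
  refine State.ext (LinearMap.ext fun A => ?_)
  simp only [evolve_val]
  congr 1
  refine Subtype.ext (LinearMap.ext fun ψ => SchwartzMap.ext fun z => ?_)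
  simp only [coe_heisenberg, conjShear_apply_apply]
  rw [shearOp_add]
  congr 1
  simp
  ring

theorem continuous_evolve (c : ℝ) : Continuous (evolve c : JointState ħ → JointState ħ) :=
  continuous_induced_rng.2 (continuous_pi fun A =>
    (continuous_apply (heisenberg ħ c A)).comp continuous_induced_dom)

theorem isHomeomorph_evolve (c : ℝ) :
    IsHomeomorph (evolve c : JointState ħ → JointState ħ) :=
  (Homeomorph.mk ⟨evolve c, evolve (-c), fun ρ => by simp [evolve_evolve, evolve_zero],
    fun ρ => by simp [evolve_evolve, evolve_zero]⟩ (continuous_evolve c)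
    (continuous_evolve (-c))).isHomeomorph

theorem isStateEvolution_evolve (hħ : ħ ≠ 0) (γ : ℝ) :
    IsStateEvolution ħ (vonNeumannOp ħ γ) fun t => evolve (γ * t) :=
  ⟨fun t => shearOp (γ * t), isUnitaryEvolution_shearOp hħ γ,
    fun t _ A => ⟨heisenberg ħ (γ * t) A, fun _ => rfl, rfl⟩⟩

theorem IsStateEvolution.unique {H : jointAlgebra ħ} {r r' : ℝ → JointState ħ → JointState ħ}
    (h : IsStateEvolution ħ H r) (h' : IsStateEvolution ħ H r') : r = r' := by
  obtain ⟨U, hU, hr⟩ := h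
  obtain ⟨V, hV, hr'⟩ := h'
  obtain rfl := hU.unique hV
  funext t ρ
  refine State.ext (LinearMap.ext fun A => ?_)
  obtain ⟨B, hB, hv⟩ := hr t ρ A
  obtain ⟨B', hB', hv'⟩ := hr' t ρ A
  rw [hv, hv', Subtype.ext (LinearMap.ext fun ψ => (hB ψ).trans (hB' ψ).symm)]

theorem value_evolve_jointQ_zero (c : ℝ) (ρ : JointState ħ) :
    (evolve c ρ).value (jointQ ħ 0) = ρ.value (jointQ ħ 0) := by
  rw [State.value, evolve_val, heisenberg_jointQ_zero, State.value]

theorem value_evolve_jointQ_one (c : ℝ) (ρ : JointState ħ) :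
    (evolve c ρ).value (jointQ ħ 1) = ρ.value (jointQ ħ 1) + c * ρ.value (jointQ ħ 0) := by
  rw [State.value, evolve_val, heisenberg_jointQ_one, map_add, map_smul, smul_eq_mul, add_re,
    re_ofReal_mul, State.value, State.value]

theorem value_evolve_jointP_zero (c : ℝ) (ρ : JointState ħ) :
    (evolve c ρ).value (jointP ħ 0) = ρ.value (jointP ħ 0) - c * ρ.value (jointP ħ 1) := by
  rw [State.value, evolve_val, heisenberg_jointP_zero, map_sub, map_smul, smul_eq_mul, sub_re,
    re_ofReal_mul, State.value, State.value]

theorem value_evolve_jointP_one (c : ℝ) (ρ : JointState ħ) :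
    (evolve c ρ).value (jointP ħ 1) = ρ.value (jointP ħ 1) := by
  rw [State.value, evolve_val, heisenberg_jointP_one, State.value]

theorem ampl_mul (j : Fin 2) (A B : particleAlgebra ħ) :
    ampl ħ j (A * B) = ampl ħ j A * ampl ħ j B :=
  Subtype.ext (IsAmpl.unique (isAmpl_ampl ħ j (A * B)) fun ψ y =>
    (isAmpl_ampl ħ j A _ y).trans
      (congrArg (A : Module.End ℂ 𝓢(ℝ, ℂ)) (isAmpl_ampl ħ j B ψ y)))

theorem value_evolve_tensor (c : ℝ) (ρ : JointState ħ) :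
    (evolve c ρ).value (tensor (opQ ħ) (opQ ħ)) =
      ρ.value (tensor (opQ ħ) (opQ ħ)) + c * (reduce 0 ρ).value (opQ ħ * opQ ħ) := by
  have h : heisenberg ħ c (tensor (opQ ħ) (opQ ħ))
      = tensor (opQ ħ) (opQ ħ) + (c : ℂ) • ampl ħ 0 (opQ ħ * opQ ħ) := by
    rw [tensor, map_mul, heisenberg_jointQ_zero, heisenberg_jointQ_one, mul_add, mul_smul_comm,
      ampl_mul]
  rw [State.value, evolve_val, h, map_add, map_smul, smul_eq_mul, add_re, re_ofReal_mul]
  rfl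

end Heisenberg

/-! ### Hamilton's equations -/

theorem eq_add_mul_of_hasDerivWithinAt {T c : ℝ} {f : ℝ → ℝ}
    (h : ∀ t ∈ Set.Icc 0 T, HasDerivWithinAt f c (Set.Icc 0 T) t) {t : ℝ}
    (ht : t ∈ Set.Icc 0 T) : f t = f 0 + c * t := by
  have h0 : (0 : ℝ) ∈ Set.Icc 0 T := ⟨le_rfl, ht.1.trans ht.2⟩
  have := (convex_Icc 0 T).norm_image_sub_le_of_norm_hasDerivWithin_le (C := 0)
    (f := fun s => f s - c * s) (f' := fun _ => 0)
    (fun s hs => by simpa using (h s hs).fun_sub ((hasDerivWithinAt_id s _).const_mul c))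
    (fun s _ => by simp) h0 ht
  simp only [zero_mul, norm_le_zero_iff, mul_zero, sub_zero, sub_eq_zero] at this
  linarith

section Motion

variable {X : Type*} {γ T : ℝ}

/-- Hamilton's equations for `h = γ q₁ p₂`, with the partial derivatives of `h` computed. -/
theorem isQRMotion_vonNeumannFun_iff {q₁ p₁ q₂ p₂ : ℝ → X → ℝ} :
    IsQRMotion (vonNeumannFun γ) T q₁ p₁ q₂ p₂ ↔ ∀ t ∈ Set.Icc 0 T, ∀ ρ,
      HasDerivWithinAt (fun s => q₁ s ρ) 0 (Set.Icc 0 T) t ∧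
      HasDerivWithinAt (fun s => p₁ s ρ) (-(γ * p₂ t ρ)) (Set.Icc 0 T) t ∧
      HasDerivWithinAt (fun s => q₂ s ρ) (γ * q₁ t ρ) (Set.Icc 0 T) t ∧
      HasDerivWithinAt (fun s => p₂ s ρ) 0 (Set.Icc 0 T) t := by
  have h1 : ∀ b x : ℝ, deriv (fun u => γ * u * b) x = γ * b := fun b x =>
    (((hasDerivAt_id x).const_mul γ).mul_const b).deriv.trans (by ring)
  have h2 : ∀ a x : ℝ, deriv (fun u => γ * a * u) x = γ * a := fun a x =>
    ((hasDerivAt_id x).const_mul (γ * a)).deriv.trans (mul_one _)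
  constructor
  · rintro ⟨a, b, c, d⟩ t ht ρ
    have a := a t ht ρ
    have b := b t ht ρ
    have c := c t ht ρ
    have d := d t ht ρ
    simp only [vonNeumannFun, deriv_const, h1, h2, neg_zero] at a b c d
    exact ⟨a, b, c, d⟩
  · intro h
    constructor <;> intro t ht ρ <;> obtain ⟨a, b, c, d⟩ := h t ht ρ <;>
      simpa only [vonNeumannFun, deriv_const, h1, h2, neg_zero]

theorem IsQRMotion.positions {q₁ p₁ q₂ p₂ : ℝ → X → ℝ}
    (h : IsQRMotion (vonNeumannFun γ) T q₁ p₁ q₂ p₂) {t : ℝ} (ht : t ∈ Set.Icc 0 T) (ρ : X) :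
    q₁ t ρ = q₁ 0 ρ ∧ q₂ t ρ = q₂ 0 ρ + γ * q₁ 0 ρ * t := by
  rw [isQRMotion_vonNeumannFun_iff] at h
  have h1 : ∀ s ∈ Set.Icc 0 T, q₁ s ρ = q₁ 0 ρ := fun s hs => by
    simpa using eq_add_mul_of_hasDerivWithinAt (f := fun s => q₁ s ρ)
      (fun u hu => (h u hu ρ).1) hs
  refine ⟨h1 t ht, eq_add_mul_of_hasDerivWithinAt (f := fun s => q₂ s ρ) (fun u hu => ?_) ht⟩
  rw [← h1 u hu]
  exact (h u hu ρ).2.2.1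

end Motion

theorem isQRMotion_evolve (ħ γ T : ℝ) (W : Set (JointState ħ)) :
    IsQRMotion (vonNeumannFun γ) T
      (fun t (ρ : W) => (evolve (γ * t) (ρ : JointState ħ)).value (jointQ ħ 0))
      (fun t (ρ : W) => (evolve (γ * t) (ρ : JointState ħ)).value (jointP ħ 0))
      (fun t (ρ : W) => (evolve (γ * t) (ρ : JointState ħ)).value (jointQ ħ 1))
      (fun t (ρ : W) => (evolve (γ * t) (ρ : JointState ħ)).value (jointP ħ 1)) := by
  have hlin : ∀ b t : ℝ, HasDerivAt (fun s => γ * s * b) (γ * b) t := fun b t => by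
    simpa using ((hasDerivAt_id t).const_mul γ).mul_const b
  rw [isQRMotion_vonNeumannFun_iff]
  intro t _ ρ
  simp only [value_evolve_jointQ_zero, value_evolve_jointQ_one, value_evolve_jointP_zero,
    value_evolve_jointP_one]
  exact ⟨hasDerivWithinAt_const _ _ _, ((hlin _ t).const_sub _).hasDerivWithinAt,
    ((hlin _ t).const_add _).hasDerivWithinAt, hasDerivWithinAt_const _ _ _⟩

/-! ### Entanglement -/

/-- The correlation that the interaction creates differs from `0` because the position of the
first particle has nonzero variance. -/
theorem value_evolve_tensor_of_isProductCondition {ħ c : ℝ} (hħ : 0 < ħ) (hc : c ≠ 0)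
    {W : Set (JointState ħ)} (hW : IsProductCondition W) {ρ : JointState ħ} (hρ : ρ ∈ W) :
    (evolve c ρ).value (tensor (opQ ħ) (opQ ħ))
        = (reduce 0 ρ).value (opQ ħ) * (reduce 1 ρ).value (opQ ħ)
          + c * (reduce 0 ρ).value (opQ ħ * opQ ħ) ∧
      (evolve c ρ).value (tensor (opQ ħ) (opQ ħ))
        ≠ (reduce 0 ρ).value (opQ ħ) * (reduce 1 ρ).value (opQ ħ) ∧
      (evolve c ρ).value (tensor (opQ ħ) (opQ ħ))
        ≠ (reduce 0 (evolve c ρ)).value (opQ ħ) * (reduce 1 (evolve c ρ)).value (opQ ħ) := by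
  have hsymm : IsSymm (opQ ħ : Module.End ℂ 𝓢(ℝ, ℂ)) := isSymm_position _
  have h := value_evolve_tensor c ρ
  rw [hW _ _ hsymm hsymm ρ hρ] at h
  have hv := variance_pos hħ (reduce 0 ρ)
  have h0 : (reduce 0 (evolve c ρ)).value (opQ ħ) = (reduce 0 ρ).value (opQ ħ) :=
    value_evolve_jointQ_zero c ρ
  have h1 : (reduce 1 (evolve c ρ)).value (opQ ħ)
      = (reduce 1 ρ).value (opQ ħ) + c * (reduce 0 ρ).value (opQ ħ) :=
    value_evolve_jointQ_one c ρ
  refine ⟨h, fun heq => ?_, fun heq => ?_⟩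
  · have : c * (reduce 0 ρ).value (opQ ħ * opQ ħ) = 0 := by linarith
    exact mul_ne_zero hc ((sq_nonneg _).trans_lt hv).ne' this
  · rw [h, h0, h1] at heq
    have : c * ((reduce 0 ρ).value (opQ ħ * opQ ħ) - (reduce 0 ρ).value (opQ ħ) ^ 2) = 0 := by
      linarith
    exact mul_ne_zero hc (sub_pos.2 hv).ne' this

theorem isEntangled_image_evolve {ħ c : ℝ} (hħ : 0 < ħ) (hc : c ≠ 0) {W : Set (JointState ħ)}
    (hne : W.Nonempty) (hW : IsProductCondition W) : IsEntangled (evolve c '' W) := by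
  obtain ⟨ρ, hρ⟩ := hne
  have hsymm : IsSymm (opQ ħ : Module.End ℂ 𝓢(ℝ, ℂ)) := isSymm_position _
  intro h
  exact (value_evolve_tensor_of_isProductCondition hħ hc hW hρ).2.2
    (h (opQ ħ) (opQ ħ) hsymm hsymm (evolve c ρ) (Set.mem_image_of_mem _ hρ))

end QR

end

theorem lemmaL6 (ħ γ T κ : ℝ) (hħ : 0 < ħ) (hγ : γ ≠ 0) (hT : 0 < T) (hκ : κ = γ * T) :
    (∃! r, QR.IsStateEvolution ħ (QR.vonNeumannOp ħ γ) r) ∧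
    ∀ r, QR.IsStateEvolution ħ (QR.vonNeumannOp ħ γ) r →
      (∀ t, IsHomeomorph (r t)) ∧
      ∀ W : Set (QR.JointState ħ),
        (∀ q₁ p₁ q₂ p₂ : ℝ → W → ℝ,
          QR.IsQRMotion (QR.vonNeumannFun γ) T q₁ p₁ q₂ p₂ →
          q₁ 0 = QR.qrValue (QR.jointQ ħ 0) W →
          q₂ 0 = QR.qrValue (QR.jointQ ħ 1) W →
          q₂ T = QR.qrValue (QR.jointQ ħ 1) W
              + κ • QR.qrValue (QR.jointQ ħ 0) W ∧
            q₁ T = QR.qrValue (QR.jointQ ħ 0) W) ∧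
        QR.IsQRMotion (QR.vonNeumannFun γ) T
          (fun t (ρ : W) => (r t ρ).value (QR.jointQ ħ 0))
          (fun t (ρ : W) => (r t ρ).value (QR.jointP ħ 0))
          (fun t (ρ : W) => (r t ρ).value (QR.jointQ ħ 1))
          (fun t (ρ : W) => (r t ρ).value (QR.jointP ħ 1)) ∧
        (∀ ρ ∈ W,
          r 0 ρ = ρ ∧
          (r T ρ).value (QR.jointQ ħ 1)
            = ρ.value (QR.jointQ ħ 1) + κ * ρ.value (QR.jointQ ħ 0) ∧
          (r T ρ).value (QR.jointQ ħ 0) = ρ.value (QR.jointQ ħ 0)) ∧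
        (W.Nonempty → QR.IsProductCondition W →
          (∀ ρ ∈ W,
            (r T ρ).value (QR.tensor (QR.opQ ħ) (QR.opQ ħ))
              = (QR.reduce 0 ρ).value (QR.opQ ħ) * (QR.reduce 1 ρ).value (QR.opQ ħ)
                + κ * (QR.reduce 0 ρ).value (QR.opQ ħ * QR.opQ ħ) ∧
            (r T ρ).value (QR.tensor (QR.opQ ħ) (QR.opQ ħ))
              ≠ (QR.reduce 0 ρ).value (QR.opQ ħ) * (QR.reduce 1 ρ).value (QR.opQ ħ) ∧
            (r T ρ).value (QR.tensor (QR.opQ ħ) (QR.opQ ħ))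
              ≠ (QR.reduce 0 (r T ρ)).value (QR.opQ ħ)
                * (QR.reduce 1 (r T ρ)).value (QR.opQ ħ)) ∧
          QR.IsEntangled (r T '' W)) := by
  have hevo := QR.isStateEvolution_evolve hħ.ne' γ
  refine ⟨⟨_, hevo, fun r hr => hr.unique hevo⟩, fun r hr => ?_⟩
  obtain rfl := hr.unique hevo
  have hκ0 : γ * T ≠ 0 := mul_ne_zero hγ hT.ne'
  have hTmem : T ∈ Set.Icc 0 T := ⟨hT.le, le_rfl⟩
  subst hκ
  refine ⟨fun t => QR.isHomeomorph_evolve _, fun W => ⟨fun q₁ p₁ q₂ p₂ hm h1 h2 => ?_,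
    QR.isQRMotion_evolve ħ γ T W, fun ρ _ => ⟨?_, QR.value_evolve_jointQ_one _ ρ,
      QR.value_evolve_jointQ_zero _ ρ⟩, fun hne hW =>
      ⟨fun ρ hρ => QR.value_evolve_tensor_of_isProductCondition hħ hκ0 hW hρ,
        QR.isEntangled_image_evolve hħ hκ0 hne hW⟩⟩⟩
  · rw [← h1, ← h2]
    refine ⟨funext fun ρ => ?_, funext fun ρ => (hm.positions hTmem ρ).1⟩
    rw [(hm.positions hTmem ρ).2, Pi.add_apply, Pi.smul_apply, smul_eq_mul]
    ring
  · simp only [mul_zero]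
    exact QR.evolve_zero ρ
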